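/- **Setting.** Let $d\in\mathbb N$, let $E$ be a finite set and $\Omega=E^{\mathbb Z^{d}\times\mathbb Z}$ with the product topology and product $\sigma$-algebra $\mathcal F$; for $\eta\in\Omega$ write $\eta_t(x)$ for its value at $(x,t)$. For $\Delta\subset\mathbb Z^{d}\times\mathbb Z$ let $\mathcal F_\Delta$ be the $\sigma$-algebra generated by the coordinates in $\Delta$. Put $(\theta_{x,t}\eta)_s(y)=\eta_{s+t}(y+x)$. Let $\mathbb P$ be a probability measure on $\Omega$ invariant under all shifts $\theta_{x,t}$, $(x,t)\in\mathbb Z^d\times\mathbb Z$. For each $\eta\in\Omega$ let $\alpha(\eta,\cdot)$ be a probability vector on $\mathbb Z^d$. Let $\mathcal R=\{y:\sup_\eta\alpha(\eta,y)>0\}$ and assume that $o\in\mathcal R$ and that there is a fixed $R\in\mathbb N$ such that $\|y\|_1\le R$ for all $y\in\mathcal R$ and $\alpha(\eta,\cdot)$ depends on $\eta$ only through its restriction to $[-R,R]^d\times\{0\}$. Under the quenched law $P_\eta$, the walk $(X_t)_{t\ge 0}$ starts at $X_0=o$ and jumps at time $t$ from $y$ to $y+z$ with probability $\alpha(\theta_{y,t}\eta,z)$.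 For a probability measure $Q$ on $\Omega$ let $P_{Q}$ be the joint law of $(\eta,X)$, with $\eta\sim Q$ and $X\sim P_\eta$ given $\eta$. The environment process is $\eta^{EP}_t=\theta_{X_t,t}\eta$, and $Q$ is called invariant under it if $P_Q(\eta^{EP}_t\in\cdot)=Q$ for all $t\ge 0$. The walk is elliptic if $\alpha(\eta,y)>0$ for all $\eta\in\Omega$ and $y\in\mathcal R$. Let $\mathcal A_{-\infty}$ be the set of all events of positive $\mathbb P$-probability of the form $$\bigcap_{i=-k}^{-1}\big\{\eta:(\theta_{\gamma_i,i}\eta)_0(y)=\sigma_i(y)\ \text{ for all } y\in[-R,R]^d\big\},$$ where $k\ge 1$, $\sigma\in\Omega$, $\gamma_{-k},\dots,\gamma_0\in\mathbb Z^d$, $\gamma_0=o$, and $\gamma_i-\gamma_{i-1}\in\mathcal R$ for $-k<i\le 0$. Let $\mathbb H=\mathbb Z^d\times\mathbb Z_{\ge 0}$, $\mathcal F_{\ge 0}=\mathcal F_{\mathbb H}$, $\Lambda(l)=\{(x,t)\in\mathbb H:\|x\|_1+|t|\ge l\}$, $\mathcal F^\infty_{\ge 0}=\bigcap_{l}\mathcal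 F_{\Lambda(l)}$, $\mathcal C(j)=\{(x,t)\in\mathbb H:\|x\|_1\le(R+1)t,\ t\ge j\}$ and $\mathcal F^\infty_\infty=\bigcap_j\mathcal F_{\mathcal C(j)}$. **Theorem 1.4 (Absolute continuity).** Let $\phi:\mathbb N\to[0,1]$ satisfy $\lim_{l\to\infty}\phi(l)=0$ and $$\sup_{B\in\mathcal F_{\Lambda(l)}}\ \sup_{A\in\mathcal A_{-\infty}}\big|\mathbb P(B\mid A)-\mathbb P(B)\big|\le\phi(l)\qquad\text{for all } l .$$ Then the sequence of Cesàro averages $\frac1n\sum_{t=0}^{n-1}P_{\mathbb P}(\eta^{EP}_t\in\cdot)$ has at least one weak subsequential limit, and every such limit $\mathbb P^{EP}$ is a probability measure on $\Omega$, invariant under the environment process, with $\mathbb P^{EP}=\mathbb P$ on $\mathcal F^\infty_\infty$, for which 1. $\mathbb P^{EP}=\mathbb P$ on $\mathcal F^\infty_{\ge 0}$; 2. $\displaystyle\sup_{B\in\mathcal F_{\Lambda(l)}}|\mathbb P(B)-\mathbb P^{EP}(B)|\le\phi(l)$ for all $l$; 3. if in addition the walk is elliptic, then $\mathbb P$ and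 $\mathbb P^{EP}$ are mutually absolutely continuous on $(\Omega,\mathcal F_{\ge 0})$. -/

import Mathlib

open MeasureTheory ProbabilityTheory Filter Topology

namespace RWDRE

/-- Space-time `ℤ^{d+1} = ℤ^d × ℤ`; a point is `(x, t)` with `x` in space and `t` in time. -/
abbrev Site (d : ℕ) : Type := (Fin d → ℤ) × ℤ

/-- The space `Ω = E^{ℤ^{d+1}}` of environments, with the product `σ`-algebra and topology. -/
abbrev Env (d : ℕ) (E : Type*) : Type _ := Site d → E

/-- The shift `θ_{x,t}`, given by `(θ_{x,t} η)_s(y) = η_{s+t}(y+x)`. -/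
def shift {d : ℕ} {E : Type*} (x : Fin d → ℤ) (t : ℤ) (η : Env d E) : Env d E :=
  fun p => η (p.1 + x, p.2 + t)

/-- The `ℓ¹`-norm on `ℤ^d`. -/
def norm1 {d : ℕ} (x : Fin d → ℤ) : ℕ := ∑ i, (x i).natAbs

/-- `Λ(l)`: the points of the forward half-space `t ≥ 0` at `ℓ¹`-distance at least `l` from the
space-time origin. -/
def farHalfSpace (d l : ℕ) : Set (Site d) :=
  {p | 0 ≤ p.2 ∧ l ≤ norm1 p.1 + p.2.natAbs}

/-- `𝓗 = ℤ^d × ℤ_{≥ 0}`, the forward half-space. -/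
def halfSpace (d : ℕ) : Set (Site d) := {p | 0 ≤ p.2}

/-- `𝓒(j)`: the points at time at least `j` of the forward cone `‖x‖₁ ≤ (R + 1) t`, `t ≥ 0`. -/
def forwardCone (d R j : ℕ) : Set (Site d) :=
  {p | 0 ≤ p.2 ∧ (norm1 p.1 : ℤ) ≤ (R + 1) * p.2 ∧ (j : ℤ) ≤ p.2}

section

variable {d : ℕ} {E : Type*}

/-- `𝓕_{≥ 0}^∞ = ⋂_l 𝓕_{Λ(l)}`, where `𝓕_Λ` (`cylinderEvents Λ`) is generated by the coordinates
in `Λ`. -/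
abbrev halfSpaceTail (d : ℕ) (E : Type*) [MeasurableSpace E] : MeasurableSpace (Env d E) :=
  ⨅ l : ℕ, cylinderEvents (farHalfSpace d l)

/-- `𝓕_∞^∞ = ⋂_j 𝓕_{𝓒(j)}`. -/
abbrev coneTail (d : ℕ) (E : Type*) [MeasurableSpace E] (R : ℕ) : MeasurableSpace (Env d E) :=
  ⨅ j : ℕ, cylinderEvents (forwardCone d R j)

/-- The jump rule of the random walk: `α η` is the probability vector `z ↦ α(η, z)` on `ℤ^d`. -/
structure Walk (d : ℕ) (E : Type*) where
  /-- the transition probabilities `α(η, ·)` -/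
  α : Env d E → PMF (Fin d → ℤ)
  /-- the range of the walk -/
  R : ℕ
  /-- `α(η, ·)` depends on `η` only through `[-R, R]^d × {0}` -/
  local_dep : ∀ η σ : Env d E,
    (∀ x : Fin d → ℤ, (∀ i, |x i| ≤ (R : ℤ)) → η (x, 0) = σ (x, 0)) → α η = α σ
  /-- possible jumps have `ℓ¹`-norm at most `R`; in particular there are finitely many of them -/
  range_bdd : ∀ (η : Env d E) (y : Fin d → ℤ), 0 < α η y → norm1 y ≤ R
  /-- the origin belongs to the jump range -/
  zero_mem : ∃ η : Env d E, 0 < α η 0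

namespace Walk

/-- The jump range `{y : sup_η α(η, y) > 0}`. -/
def jumpRange (W : Walk d E) : Set (Fin d → ℤ) := {y | ∃ η, 0 < W.α η y}

/-- The walk is elliptic: every jump in the jump range has positive probability in every
environment. -/
def IsElliptic (W : Walk d E) : Prop := ∀ y ∈ W.jumpRange, ∀ η, 0 < W.α η y

/-- The family `𝓐_{-∞}` of possible observations along backward paths ending at `(o, 0)`: for
`k ≥ 1`, a path `γ_{-k}, …, γ_0 = o` with increments in the jump range and `σ ∈ Ω`, the event that
the environment seen from `(γ_i, i)` equals `σ_i` on `[-R, R]^d` for `i = -k, …, -1`, provided that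
this event has positive probability. Only the values `γ_i`, `-k ≤ i ≤ 0`, matter. -/
def observations [MeasurableSpace E] (W : Walk d E) (P : Measure (Env d E)) :
    Set (Set (Env d E)) :=
  {A | ∃ (k : ℕ) (γ : ℤ → Fin d → ℤ) (σ : Env d E), 1 ≤ k ∧ γ 0 = 0 ∧
    (∀ i : ℤ, -k < i → i ≤ 0 → γ i - γ (i - 1) ∈ W.jumpRange) ∧
    A = {η | ∀ i : ℤ, -k ≤ i → i ≤ -1 → ∀ y : Fin d → ℤ, (∀ j, |y j| ≤ (W.R : ℤ)) →
      shift (γ i) i η (y, 0) = σ (y, i)} ∧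
    0 < P A}

/-- The transition kernel of the walk in the fixed environment `η` at time `n`: from a history
ending at `y`, jump to `y + z` with probability `α(θ_{y,n} η, z)`. -/
noncomputable def step (W : Walk d E) (η : Env d E) (n : ℕ) :
    Kernel ((i : Finset.Iic n) → Fin d → ℤ) (Fin d → ℤ) where
  toFun h :=
    ((W.α (shift (h ⟨n, Finset.mem_Iic.2 le_rfl⟩) n η)).map
      (fun z => h ⟨n, Finset.mem_Iic.2 le_rfl⟩ + z)).toMeasure
  measurable' := measurable_of_countable _

instance (W : Walk d E) (η : Env d E) (n : ℕ) : IsMarkovKernel (W.step η n) :=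
  ⟨fun h => by change IsProbabilityMeasure (PMF.toMeasure _); infer_instance⟩

/-- The quenched law `P_η` on trajectories `(X_t)_{t ≥ 0}`, started at `X_0 = o`. -/
noncomputable def quenchedLaw (W : Walk d E) (η : Env d E) : Measure (ℕ → Fin d → ℤ) :=
  Kernel.traj (X := fun _ => Fin d → ℤ) (W.step η) 0 (fun _ => 0)

instance (W : Walk d E) (η : Env d E) : IsProbabilityMeasure (W.quenchedLaw η) := by
  unfold quenchedLaw; infer_instance

theorem step_singleton (W : Walk d E) (η : Env d E) (n : ℕ) (p : ℕ → Fin d → ℤ) :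
    W.step η n (Preorder.frestrictLe n p) {p (n + 1)} =
      W.α (shift (p n) n η) (p (n + 1) - p n) := by
  change PMF.toMeasure (PMF.map (fun z => p n + z) (W.α (shift (p n) n η))) {p (n + 1)} = _
  rw [PMF.toMeasure_apply_singleton _ _ (measurableSet_singleton _), PMF.map_apply,
    tsum_eq_single (p (n + 1) - p n)]
  · simp
  · intro b hb
    rw [if_neg]
    rintro h
    exact hb (by rw [h]; abel)

/-- Path probabilities under the quenched law. -/
theorem quenchedLaw_path (W : Walk d E) (η : Env d E) (p : ℕ → Fin d → ℤ) (hp : p 0 = 0) (n : ℕ) :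
    W.quenchedLaw η {X | ∀ i ≤ n, X i = p i} =
      ∏ i ∈ Finset.range n, W.α (shift (p i) i η) (p (i + 1) - p i) := by
  have hset : ∀ m : ℕ, {X : ℕ → Fin d → ℤ | ∀ i ≤ m, X i = p i} =
      Preorder.frestrictLe (π := fun _ => Fin d → ℤ) m ⁻¹' {Preorder.frestrictLe m p} := by
    intro m
    ext X
    simp [funext_iff, Preorder.frestrictLe]
  have hpt : ∀ m : ℕ, W.quenchedLaw η {X | ∀ i ≤ m, X i = p i} =
      Kernel.partialTraj (X := fun _ => Fin d → ℤ) (W.step η) 0 m (fun _ => 0)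
        {Preorder.frestrictLe m p} := by
    intro m
    rw [hset, quenchedLaw, ← Kernel.traj_map_frestrictLe_apply,
      Measure.map_apply (Preorder.measurable_frestrictLe m) (measurableSet_singleton _)]
  induction n with
  | zero =>
    rw [hpt, Kernel.partialTraj_self, Kernel.id_apply]
    rw [Measure.dirac_apply' _ (measurableSet_singleton _)]
    have : (fun _ => 0 : (i : Finset.Iic 0) → Fin d → ℤ) = Preorder.frestrictLe 0 p := by
      funext i
      have hi : (i : ℕ) = 0 := Nat.le_zero.1 (Finset.mem_Iic.1 i.2)
      simp [Preorder.frestrictLe, hi, hp]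
    rw [this]; simp
  | succ n ih =>
    have h2 : {X : ℕ → Fin d → ℤ | ∀ i ≤ n + 1, X i = p i} =
        (fun X : ℕ → Fin d → ℤ =>
          (Preorder.frestrictLe (π := fun _ => Fin d → ℤ) n X, X (n + 1))) ⁻¹'
          ({Preorder.frestrictLe n p} ×ˢ {p (n + 1)}) := by
      rw [Set.mk_preimage_prod, ← hset]
      ext X
      constructor
      · intro h
        exact ⟨fun i hi => h i (by omega), h (n + 1) le_rfl⟩
      · rintro ⟨h, h'⟩ i hi
        rcases Nat.lt_or_ge n i with hlt | hle
        · have : i = n + 1 := by omega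
          subst this; exact h'
        · exact h i hle
    rw [h2, quenchedLaw, ← Measure.map_apply _ ((measurableSet_singleton _).prod
      (measurableSet_singleton _)), ← Kernel.partialTraj_compProd_eq_map_traj (Nat.zero_le n),
      Measure.compProd_apply_prod (measurableSet_singleton _) (measurableSet_singleton _),
      lintegral_singleton, step_singleton, ← hpt, ih, Finset.prod_range_succ, mul_comm]
    exact (Preorder.measurable_frestrictLe n).prodMk (measurable_pi_apply _)

theorem measurable_shift [MeasurableSpace E] (x : Fin d → ℤ) (t : ℤ) :
    Measurable (shift (E := E) x t) :=
  measurable_pi_lambda _ fun _ => measurable_pi_apply _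

theorem measurable_α [Finite E] [MeasurableSpace E] [DiscreteMeasurableSpace E] (W : Walk d E)
    (z : Fin d → ℤ) : Measurable fun η => W.α η z := by
  have hfin : Set.Finite {x : Fin d → ℤ | ∀ i, |x i| ≤ (W.R : ℤ)} := by
    refine (Set.finite_Icc (fun _ : Fin d => -(W.R : ℤ)) (fun _ => (W.R : ℤ))).subset ?_
    intro x hx
    exact ⟨fun i => (abs_le.1 (hx i)).1, fun i => (abs_le.1 (hx i)).2⟩
  have : Finite {x : Fin d → ℤ | ∀ i, |x i| ≤ (W.R : ℤ)} := hfin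
  let r : Env d E → ({x : Fin d → ℤ | ∀ i, |x i| ≤ (W.R : ℤ)} → E) := fun η x => η (x.1, 0)
  have hr : Measurable r := measurable_pi_lambda _ fun _ => measurable_pi_apply _
  have hfac : Function.FactorsThrough (fun η => W.α η z) r := by
    intro η σ h
    have : W.α η = W.α σ := W.local_dep η σ fun x hx => congrFun h ⟨x, hx⟩
    simp only [this]
  rw [← hfac.extend_comp (fun _ => 0)]
  exact (measurable_of_countable _).comp hr

theorem measurable_quenchedLaw [Finite E] [MeasurableSpace E] [DiscreteMeasurableSpace E]
    (W : Walk d E) : Measurable W.quenchedLaw := by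
  refine Measurable.measure_of_isPiSystem_of_isProbabilityMeasure
    (generateFrom_measurableCylinders (α := fun _ : ℕ => Fin d → ℤ)).symm
    isPiSystem_measurableCylinders ?_
  intro s hs
  obtain ⟨N, S, mS, rfl⟩ : ∃ N S, MeasurableSet S ∧
      s = cylinder (α := fun _ : ℕ => Fin d → ℤ) (Finset.Iic N) S := by
    simpa [measurableCylinders_nat] using hs
  have hS : cylinder (α := fun _ : ℕ => Fin d → ℤ) (Finset.Iic N) S =
      ⋃ q ∈ S, {X | ∀ i ≤ N, X i = if h : i ≤ N then q ⟨i, Finset.mem_Iic.2 h⟩ else 0} := by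
    ext X
    simp only [mem_cylinder, Set.mem_iUnion, Set.mem_ofPred_eq, exists_prop]
    constructor
    · intro h
      exact ⟨_, h, fun i hi => by simp [hi]⟩
    · rintro ⟨q, hq, h⟩
      convert hq using 1
      funext i
      have hi := Finset.mem_Iic.1 i.2
      simpa [hi] using h i hi
  have hmeas : ∀ p : ℕ → Fin d → ℤ,
      Measurable fun η => W.quenchedLaw η {X | ∀ i ≤ N, X i = p i} := by
    intro p
    by_cases hp : p 0 = 0
    · simp only [quenchedLaw_path W _ p hp]
      exact Finset.measurable_prod _ fun i _ => (W.measurable_α _).comp (measurable_shift _ _)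
    · have h0 : ∀ η, W.quenchedLaw η {X | ∀ i ≤ N, X i = p i} = 0 := by
        intro η
        have h1 := quenchedLaw_path W η (fun _ => 0) rfl 0
        simp only [Finset.range_zero, Finset.prod_empty] at h1
        refine measure_mono_null (t := {X | ∀ i ≤ 0, X i = 0}ᶜ) ?_ ?_
        · intro X hX hX'
          exact hp ((hX 0 (Nat.zero_le _)).symm.trans (hX' 0 le_rfl))
        · rw [prob_compl_eq_zero_iff]
          · exact h1
          · simp only [Nat.le_zero, forall_eq]
            exact measurable_pi_apply 0 (measurableSet_singleton _)
      simp only [h0, measurable_const]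
  have hms : ∀ p : ℕ → Fin d → ℤ,
      MeasurableSet {X : ℕ → Fin d → ℤ | ∀ i ≤ N, X i = p i} := by
    intro p
    have : {X : ℕ → Fin d → ℤ | ∀ i ≤ N, X i = p i} =
        ⋂ i ∈ Set.Iic N, (fun X => X i) ⁻¹' {p i} := by
      ext X; simp
    rw [this]
    exact MeasurableSet.biInter (Set.to_countable _) fun i _ =>
      measurable_pi_apply i (measurableSet_singleton _)
  have hsum : ∀ η, W.quenchedLaw η (cylinder (Finset.Iic N) S) = ∑' q : S, W.quenchedLaw η
      {X | ∀ i ≤ N, X i = if h : i ≤ N then q.1 ⟨i, Finset.mem_Iic.2 h⟩ else 0} := by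
    intro η
    rw [hS, measure_biUnion (Set.to_countable S)]
    · intro q _ q' _ hne
      refine Set.disjoint_left.2 fun X hX hX' => hne ?_
      funext i
      have hi := Finset.mem_Iic.1 i.2
      have e1 := hX i hi
      have e2 := hX' i hi
      simp only [hi, dif_pos] at e1 e2
      exact e1.symm.trans e2
    · exact fun q _ => hms _
  simp only [hsum]
  exact Measurable.tsum fun q => hmeas _

/-- The quenched law as a Markov kernel from environments to trajectories. -/
noncomputable def quenched [Finite E] [MeasurableSpace E] [DiscreteMeasurableSpace E]
    (W : Walk d E) : Kernel (Env d E) (ℕ → Fin d → ℤ) where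
  toFun := W.quenchedLaw
  measurable' := W.measurable_quenchedLaw

instance [Finite E] [MeasurableSpace E] [DiscreteMeasurableSpace E] (W : Walk d E) :
    IsMarkovKernel W.quenched :=
  ⟨fun η => inferInstanceAs (IsProbabilityMeasure (W.quenchedLaw η))⟩

/-- The joint law `P_P` of `(η, X)`: `P_P(B × A) = ∫_B P_η(A) dP(η)`. -/
noncomputable def jointLaw [Finite E] [MeasurableSpace E] [DiscreteMeasurableSpace E]
    (W : Walk d E) (P : Measure (Env d E)) : Measure (Env d E × (ℕ → Fin d → ℤ)) :=
  P ⊗ₘ W.quenched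

end Walk

/-- The environment process `η_t^{EP} = θ_{X_t, t} η`. -/
def envProcess (t : ℕ) (ω : Env d E × (ℕ → Fin d → ℤ)) : Env d E :=
  shift (ω.2 t) t ω.1

theorem measurable_envProcess [MeasurableSpace E] (t : ℕ) :
    Measurable (envProcess (d := d) (E := E) t) := by
  have h : Measurable fun q : Env d E × (Fin d → ℤ) => shift q.2 (t : ℤ) q.1 :=
    measurable_from_prod_countable_left fun y => Walk.measurable_shift y t
  exact h.comp (measurable_fst.prodMk ((measurable_pi_apply t).comp measurable_snd))

namespace Walk

variable [Finite E] [MeasurableSpace E] [DiscreteMeasurableSpace E]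

/-- The law `P_P(η_t^{EP} ∈ ·)`. -/
noncomputable def envLaw (W : Walk d E) (P : Measure (Env d E)) (t : ℕ) : Measure (Env d E) :=
  (W.jointLaw P).map (envProcess t)

instance (W : Walk d E) (P : Measure (Env d E)) [IsProbabilityMeasure P] (t : ℕ) :
    IsProbabilityMeasure (W.envLaw P t) := by
  unfold envLaw jointLaw
  exact Measure.isProbabilityMeasure_map (measurable_envProcess t).aemeasurable

/-- `Q` is invariant under the environment process: started from `Q`, the process has law `Q` at
all times. -/
def IsInvariant (W : Walk d E) (Q : Measure (Env d E)) : Prop := ∀ t : ℕ, W.envLaw Q t = Q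

/-- The Cesàro average `(n+1)⁻¹ ∑_{t=0}^{n} P_P(η_t^{EP} ∈ ·)`. -/
noncomputable def cesaro (W : Walk d E) (P : ProbabilityMeasure (Env d E)) (n : ℕ) :
    ProbabilityMeasure (Env d E) :=
  ⟨((n : ENNReal) + 1)⁻¹ • ∑ t ∈ Finset.range (n + 1), W.envLaw (P : Measure (Env d E)) t, ⟨by
    simp only [Measure.smul_apply, Measure.finsetSum_apply, measure_univ, Finset.sum_const,
      Finset.card_range, smul_eq_mul, nsmul_eq_mul, mul_one, Nat.cast_add, Nat.cast_one]
    exact ENNReal.inv_mul_cancel (by simp) (by finiteness)⟩⟩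

/-- `Q` is a law `P^{EP}` of the environment seen from the walker: a weak limit, along a
subsequence, of the Cesàro averages of the laws of the environment process started from `P`. -/
def IsEnvLimit [TopologicalSpace E] [DiscreteTopology E] (W : Walk d E)
    (P Q : ProbabilityMeasure (Env d E)) : Prop :=
  ∃ n : ℕ → ℕ, StrictMono n ∧ Tendsto (fun k => W.cesaro P (n k)) atTop (𝓝 Q)

end Walk

end

end RWDRE

/-!
Since `α` is local, the transition kernel of the environment process is Feller, so weak limits of
the Cesàro averages are invariant (Krylov–Bogoliubov).

Decompose the law of `η_t^{EP}` according to the last `t` jumps and to the patterns seen along the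
way. By stationarity each piece is a multiple of `P` restricted to an event recording the
environment along a backward path ending at the origin. So the law of `η_t^{EP}` is a convex
combination of `P` and of the conditional laws in the mixing hypothesis, and so are the Cesàro
averages. Bounds on clopen events pass to the weak limit `Q`, and from there to the `σ`-algebra
generated, giving `|Q - P| ≤ φ l` on `𝓕_{Λ(l)}`; let `l → ∞` for the tail `σ`-algebra.

For absolute continuity, move an event `B ∈ 𝓕_{≥ 0}` to time `t`, where `Q` and `P` differ by at
most `φ t`. Invariance gives `Q B ≤ Q (⋃ x, θ_{x,t}⁻¹ B)`, a union of `P`-null events if `P B = 0`.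
Conversely, if `Q B = 0` and the jump `z` always has positive probability, then the walk sits at
`t z` at time `t` with positive probability in every environment, so `Q (θ_{tz,t}⁻¹ B) = 0`.
-/

namespace RWDRE

open scoped ENNReal NNReal BoundedContinuousFunction

section Measure

section CloseOn

variable {Ω : Type*} {m mΩ : MeasurableSpace Ω} {μ ν : Measure Ω} {ε : ℝ}

/-- `μ` and `ν` are within total variation distance `ε` of each other on the `σ`-algebra `m`, the
distance being `sup_B |μ B - ν B|`, without a factor `2`. -/
def CloseOn (m : MeasurableSpace Ω) {_ : MeasurableSpace Ω} (ε : ℝ) (μ ν : Measure Ω) : Prop :=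
  ∀ B, MeasurableSet[m] B → |μ.real B - ν.real B| ≤ ε

namespace CloseOn

theorem symm (h : CloseOn m ε μ ν) : CloseOn m ε ν μ :=
  fun B hB => abs_sub_comm (μ.real B) (ν.real B) ▸ h B hB

theorem of_forall_le_add (hm : m ≤ mΩ) [IsProbabilityMeasure μ] [IsProbabilityMeasure ν]
    (hε : 0 ≤ ε) (h : ∀ B, MeasurableSet[m] B → μ B ≤ ν B + ENNReal.ofReal ε) :
    CloseOn m ε μ ν := by
  have hreal : ∀ B, MeasurableSet[m] B → μ.real B ≤ ν.real B + ε := fun B hB => by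
    have := ENNReal.toReal_mono (by finiteness) (h B hB)
    rwa [ENNReal.toReal_add (by finiteness) (by finiteness), ENNReal.toReal_ofReal hε] at this
  intro B hB
  have hcompl := hreal Bᶜ hB.compl
  rw [probReal_compl_eq_one_sub (hm B hB), probReal_compl_eq_one_sub (hm B hB)] at hcompl
  exact abs_le.2 ⟨by linarith, by linarith [hreal B hB]⟩

variable [IsFiniteMeasure μ] [IsFiniteMeasure ν]

theorem measure_le_add (h : CloseOn m ε μ ν) {B : Set Ω} (hB : MeasurableSet[m] B) :
    μ B ≤ ν B + ENNReal.ofReal ε := by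
  have hε : 0 ≤ ε := (abs_nonneg _).trans (h B hB)
  rw [← ofReal_measureReal (μ := μ), ← ofReal_measureReal (μ := ν),
    ← ENNReal.ofReal_add measureReal_nonneg hε]
  exact ENNReal.ofReal_le_ofReal (by linarith [(abs_le.1 (h B hB)).2])

variable {m : ℕ → MeasurableSpace Ω} {φ : ℕ → ℝ}

theorem measure_eq_of_iInf (h : ∀ l, CloseOn (m l) (φ l) μ ν) (hφ : Tendsto φ atTop (𝓝 0))
    {B : Set Ω} (hB : MeasurableSet[⨅ l, m l] B) : μ B = ν B := by
  have hle : |μ.real B - ν.real B| ≤ 0 :=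
    ge_of_tendsto' hφ fun l => h l B (iInf_le m l B hB)
  rw [← measureReal_eq_measureReal_iff]
  exact sub_eq_zero.1 (abs_nonpos_iff.1 hle)

theorem measure_eq_zero (h : ∀ l, CloseOn (m l) (φ l) μ ν) (hφ : Tendsto φ atTop (𝓝 0))
    {U : ℕ → Set Ω} (hU : ∀ l, MeasurableSet[m l] (U l)) (hν : ∀ l, ν (U l) = 0)
    {B : Set Ω} (hB : ∀ l, μ B ≤ μ (U l)) : μ B = 0 := by
  have hle : ∀ l, μ B ≤ ENNReal.ofReal (φ l) := fun l =>
    (hB l).trans (by simpa only [hν l, zero_add] using (h l).measure_le_add (hU l))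
  have hlim : Tendsto (fun l => ENNReal.ofReal (φ l)) atTop (𝓝 0) := by
    simpa only [ENNReal.ofReal_zero] using ENNReal.tendsto_ofReal hφ
  exact nonpos_iff_eq_zero.1 (ge_of_tendsto' hlim hle)

end CloseOn

end CloseOn

variable {Ω : Type*} [mΩ : MeasurableSpace Ω]

/-- The convex cone of the measures that give `B` at most the fraction `q` of their mass. -/
def fractionLE (B : Set Ω) (q : ℝ≥0∞) : Submodule ℝ≥0∞ (Measure Ω) where
  carrier := {μ | μ B ≤ q * μ Set.univ}
  zero_mem' := by simp
  add_mem' {μ ν} hμ hν := by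
    simpa only [Set.mem_ofPred_eq, Measure.add_apply, mul_add] using add_le_add hμ hν
  smul_mem' c μ hμ := by
    simpa only [Set.mem_ofPred_eq, Measure.smul_apply, smul_eq_mul, mul_left_comm] using
      mul_le_mul_right hμ c

theorem mem_fractionLE {B : Set Ω} {q : ℝ≥0∞} {μ : Measure Ω} :
    μ ∈ fractionLE B q ↔ μ B ≤ q * μ Set.univ :=
  Iff.rfl

theorem restrict_mem_fractionLE {A B : Set Ω} (hA : MeasurableSet A) (hB : MeasurableSet B)
    {q : ℝ≥0∞} {μ : Measure Ω} [IsFiniteMeasure μ] (h : μ[|A] B ≤ q) :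
    μ.restrict A ∈ fractionLE B q := by
  rw [mem_fractionLE, Measure.restrict_apply_univ, Measure.restrict_apply hB, Set.inter_comm,
    ← cond_mul_eq_inter hA]
  gcongr

theorem sum_restrict_preimage_singleton {ι : Type*} [Fintype ι] [MeasurableSpace ι]
    [MeasurableSingletonClass ι] {f : Ω → ι} (hf : Measurable f) (μ : Measure Ω) :
    ∑ i, μ.restrict (f ⁻¹' {i}) = μ := by
  have hdisj : Pairwise (Function.onFun Disjoint fun i => f ⁻¹' {i}) := fun i j hij =>
    (Set.disjoint_singleton.2 hij).preimage f
  rw [← Measure.sum_fintype,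
    ← Measure.restrict_iUnion hdisj fun i => hf (measurableSet_singleton i),
    ← Set.preimage_iUnion, Set.iUnion_of_singleton, Set.preimage_univ, Measure.restrict_univ]

theorem comp_finsetSum {Ω' ι : Type*} [MeasurableSpace Ω'] (κ : Kernel Ω Ω') (s : Finset ι)
    (μ : ι → Measure Ω) : κ ∘ₘ (∑ i ∈ s, μ i) = ∑ i ∈ s, κ ∘ₘ μ i := by
  classical
  induction s using Finset.induction_on with
  | empty => simp
  | insert i s hi ih => rw [Finset.sum_insert hi, Finset.sum_insert hi, Measure.comp_add, ih]

theorem measure_le_add_of_isSetAlgebra {μ ν : Measure Ω} [IsFiniteMeasure μ] [IsFiniteMeasure ν]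
    {C : Set (Set Ω)} (hC : IsSetAlgebra C) (hCm : MeasurableSpace.generateFrom C ≤ mΩ)
    {c : ℝ≥0∞} (h : ∀ A ∈ C, μ A ≤ ν A + c) {B : Set Ω}
    (hB : MeasurableSet[MeasurableSpace.generateFrom C] B) : μ B ≤ ν B + c := by
  refine ENNReal.le_of_forall_pos_le_add fun ε hε _ => ?_
  obtain ⟨A, hA, hAB⟩ := @exists_measure_symmDiff_lt_of_generateFrom_isSetRing _
    (MeasurableSpace.generateFrom C) ((μ + ν).trim hCm) _ C hC.isSetRing
    ⟨{Set.univ}, Set.countable_singleton _, by simpa using hC.univ_mem, by simp⟩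
    rfl B hB ε (by exact_mod_cast hε)
  rw [trim_measurableSet_eq hCm ((MeasurableSpace.measurableSet_generateFrom hA).symmDiff hB),
    Measure.add_apply] at hAB
  have hμ : μ B ≤ μ (symmDiff A B) + μ A :=
    (measure_mono (le_symmDiff_sup_left A B)).trans (measure_union_le _ _)
  have hν : ν A ≤ ν (symmDiff A B) + ν B :=
    (measure_mono (le_symmDiff_sup_right A B)).trans (measure_union_le _ _)
  calc μ B ≤ μ (symmDiff A B) + (ν (symmDiff A B) + ν B + c) :=
        hμ.trans (by gcongr; exact (h A hA).trans (by gcongr))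
    _ = ν B + c + (μ (symmDiff A B) + ν (symmDiff A B)) := by ring
    _ ≤ ν B + c + ε := by gcongr

end Measure

section Feller

variable {Ω : Type*} [TopologicalSpace Ω] [MeasurableSpace Ω]

/-- The Feller property of a kernel: it maps bounded continuous functions to continuous
functions. -/
def IsFeller (κ : Kernel Ω Ω) : Prop :=
  ∀ f : Ω →ᵇ ℝ≥0, Continuous fun x => ∫⁻ y, f y ∂κ x

theorem lintegral_le_edist_zero [OpensMeasurableSpace Ω] (μ : Measure Ω) [IsProbabilityMeasure μ]
    (f : Ω →ᵇ ℝ≥0) : ∫⁻ x, f x ∂μ ≤ edist 0 f := by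
  simpa only [measure_univ, mul_one] using f.lintegral_le_edist_mul μ

variable {ι : Type*} {L : Filter ι} {μ : ι → ProbabilityMeasure Ω} {ν : ProbabilityMeasure Ω}
  {κ : Kernel Ω Ω} [IsMarkovKernel κ]

theorem IsFeller.tendsto_lintegral_comp [OpensMeasurableSpace Ω] (hκ : IsFeller κ)
    (hμ : Tendsto μ L (𝓝 ν)) (f : Ω →ᵇ ℝ≥0) :
    Tendsto (fun i => ∫⁻ x, f x ∂(κ ∘ₘ (μ i : Measure Ω))) L
      (𝓝 (∫⁻ x, f x ∂(κ ∘ₘ (ν : Measure Ω)))) := by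
  have hfin : ∀ x, ∫⁻ y, f y ∂κ x ≠ ∞ := fun x =>
    ne_top_of_le_ne_top (edist_ne_top 0 f) (lintegral_le_edist_zero (κ x) f)
  have hle : ∀ x, (∫⁻ y, f y ∂κ x).toNNReal ≤ nndist 0 f := fun x => by
    simpa only [edist_nndist, ENNReal.toNNReal_coe] using
      ENNReal.toNNReal_mono (edist_ne_top 0 f) (lintegral_le_edist_zero (κ x) f)
  let g : Ω →ᵇ ℝ≥0 := BoundedContinuousFunction.mkOfBound
    ⟨fun x => (∫⁻ y, f y ∂κ x).toNNReal,
      ENNReal.continuousOn_toNNReal.comp_continuous (hκ f) hfin⟩ (nndist 0 f) fun x y => by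
        rw [NNReal.dist_eq]
        exact abs_sub_le_of_nonneg_of_le (NNReal.coe_nonneg _) (hle x) (NNReal.coe_nonneg _) (hle y)
  have hg : ∀ ρ : ProbabilityMeasure Ω,
      ∫⁻ x, f x ∂(κ ∘ₘ (ρ : Measure Ω)) = ∫⁻ x, g x ∂(ρ : Measure Ω) := fun ρ => by
    rw [Measure.lintegral_bind κ.aemeasurable (by fun_prop)]
    exact lintegral_congr fun x => (ENNReal.coe_toNNReal (hfin x)).symm
  simp only [hg]
  exact ProbabilityMeasure.tendsto_iff_forall_lintegral_tendsto.1 hμ g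

theorem IsFeller.invariant_of_tendsto [L.NeBot] [HasOuterApproxClosed Ω] [BorelSpace Ω]
    (hκ : IsFeller κ) (hμ : Tendsto μ L (𝓝 ν)) {a : ι → ℝ≥0∞} (ha : Tendsto a L (𝓝 0))
    {ρ ρ' : ι → Measure Ω} [∀ i, IsProbabilityMeasure (ρ i)] [∀ i, IsProbabilityMeasure (ρ' i)]
    (h : ∀ i, κ ∘ₘ (μ i : Measure Ω) + a i • ρ i = μ i + a i • ρ' i) :
    κ.Invariant (ν : Measure Ω) := by
  refine ext_of_forall_lintegral_eq_of_IsFiniteMeasure fun f => ?_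
  have hvanish : ∀ (θ : ι → Measure Ω) [∀ i, IsProbabilityMeasure (θ i)],
      Tendsto (fun i => a i * ∫⁻ x, f x ∂θ i) L (𝓝 0) := fun θ _ => by
    have hbound : Tendsto (fun i => a i * edist 0 f) L (𝓝 0) := by
      simpa using ENNReal.Tendsto.mul_const ha (Or.inr (edist_ne_top 0 f))
    exact tendsto_of_tendsto_of_tendsto_of_le_of_le tendsto_const_nhds hbound (fun _ => zero_le)
      fun i => mul_le_mul_right (lintegral_le_edist_zero (θ i) f) _
  have hleft := (hκ.tendsto_lintegral_comp hμ f).add (hvanish ρ)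
  have hright :=
    (ProbabilityMeasure.tendsto_iff_forall_lintegral_tendsto.1 hμ f).add (hvanish ρ')
  rw [add_zero] at hleft hright
  refine tendsto_nhds_unique hleft (hright.congr fun i => ?_)
  simpa only [lintegral_add_measure, lintegral_smul_measure, smul_eq_mul] using
    congrArg (fun θ => ∫⁻ x, f x ∂θ) (h i).symm

end Feller

section Shift

variable {d : ℕ} {E : Type*}

theorem shift_shift (x y : Fin d → ℤ) (s t : ℤ) (η : Env d E) :
    shift x s (shift y t η) = shift (x + y) (s + t) η := by
  funext p
  simp only [shift, add_assoc]

theorem shift_zero (η : Env d E) : shift 0 0 η = η := by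
  funext p
  simp only [shift, add_zero]

theorem continuous_shift [TopologicalSpace E] (x : Fin d → ℤ) (t : ℤ) :
    Continuous (shift (E := E) x t) :=
  continuous_pi fun _ => continuous_apply _

end Shift

section Pattern

variable {d : ℕ} {E : Type*}

/-- The box `[-R, R]^d`. -/
abbrev Box (d R : ℕ) : Type := {x : Fin d → ℤ // ∀ i, |x i| ≤ (R : ℤ)}

instance (d R : ℕ) : Finite (Box d R) :=
  ((Set.finite_Icc (fun _ : Fin d => -(R : ℤ)) fun _ => (R : ℤ)).subset fun _ hx =>
    ⟨fun i => (abs_le.1 (hx i)).1, fun i => (abs_le.1 (hx i)).2⟩ :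
    {x : Fin d → ℤ | ∀ i, |x i| ≤ (R : ℤ)}.Finite)

/-- The restriction of `η` to `[-R, R]^d × {0}`: what a walk of range `R` sees at the origin. -/
def pattern (R : ℕ) (η : Env d E) : Box d R → E := fun x => η (x.1, 0)

theorem measurable_pattern [MeasurableSpace E] (R : ℕ) : Measurable (pattern (d := d) (E := E) R) :=
  measurable_pi_lambda _ fun _ => measurable_pi_apply _

theorem continuous_pattern [TopologicalSpace E] (R : ℕ) :
    Continuous (pattern (d := d) (E := E) R) :=
  continuous_pi fun _ => continuous_apply _

theorem Walk.α_eq_of_pattern_eq (W : Walk d E) {η σ : Env d E}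
    (h : pattern W.R η = pattern W.R σ) : W.α η = W.α σ :=
  W.local_dep η σ fun x hx => congrFun h ⟨x, hx⟩

theorem Walk.continuous_α [TopologicalSpace E] [DiscreteTopology E] (W : Walk d E)
    (z : Fin d → ℤ) : Continuous fun η => W.α η z := by
  have hfac : Function.FactorsThrough (fun η => W.α η z) (pattern W.R) := fun _ _ h =>
    congrArg (fun p : PMF (Fin d → ℤ) => p z) (W.α_eq_of_pattern_eq h)
  rw [← hfac.extend_comp fun _ => 0]
  exact continuous_of_discreteTopology.comp (continuous_pattern W.R)

end Pattern

namespace Walk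

section Jumps

variable {d : ℕ} {E : Type*} (W : Walk d E)

theorem finite_jumpRange : W.jumpRange.Finite := by
  refine (Set.finite_Icc (fun _ => -(W.R : ℤ)) fun _ => (W.R : ℤ)).subset ?_
  rintro y ⟨η, hy⟩
  have hle : ∀ i, |y i| ≤ (W.R : ℤ) := fun i => by
    have hi : (y i).natAbs ≤ norm1 y :=
      Finset.single_le_sum (f := fun i => (y i).natAbs) (fun _ _ => Nat.zero_le _)
        (Finset.mem_univ i)
    rw [Int.abs_eq_natAbs]
    exact_mod_cast hi.trans (W.range_bdd η y hy)
  exact ⟨fun i => (abs_le.1 (hle i)).1, fun i => (abs_le.1 (hle i)).2⟩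

/-- The jump range as a finite set, over which the one-step averages are summed. -/
noncomputable def jumps : Finset (Fin d → ℤ) := W.finite_jumpRange.toFinset

theorem lintegral_α (η : Env d E) (f : (Fin d → ℤ) → ℝ≥0∞) :
    ∫⁻ z, f z ∂(W.α η).toMeasure = ∑ z ∈ W.jumps, W.α η z * f z := by
  rw [lintegral_countable', tsum_eq_sum (s := W.jumps)]
  · exact Finset.sum_congr rfl fun z _ => by
      rw [PMF.toMeasure_apply_singleton _ _ (measurableSet_singleton z), mul_comm]
  · intro z hz
    have hα : W.α η z = 0 := by
      by_contra h
      exact hz (W.finite_jumpRange.mem_toFinset.2 ⟨η, pos_iff_ne_zero.2 h⟩)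
    rw [PMF.toMeasure_apply_singleton _ _ (measurableSet_singleton z), hα, mul_zero]

theorem lintegral_map_shift_α [MeasurableSpace E] (η : Env d E)
    {f : Env d E → ℝ≥0∞} (hf : Measurable f) :
    ∫⁻ ζ, f ζ ∂(W.α η).toMeasure.map (fun z => shift z 1 η) =
      ∑ z ∈ W.jumps, W.α η z * f (shift z 1 η) := by
  rw [lintegral_map hf (measurable_of_countable _), lintegral_α]

theorem ae_quenchedLaw_zero (η : Env d E) : ∀ᵐ X ∂W.quenchedLaw η, X 0 = 0 := by
  have h0 : W.quenchedLaw η {X | X 0 = 0} = 1 := by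
    simpa only [Nat.le_zero, forall_eq, Finset.range_zero, Finset.prod_empty] using
      W.quenchedLaw_path η (fun _ => 0) rfl 0
  exact (prob_compl_eq_zero_iff (measurable_pi_apply 0 (measurableSet_singleton 0))).2 h0

theorem quenchedLaw_path_pos {p : ℕ → Fin d → ℤ} (h0 : p 0 = 0)
    (hp : ∀ i η, 0 < W.α η (p (i + 1) - p i)) (η : Env d E) (t : ℕ) :
    0 < W.quenchedLaw η {X | ∀ i ≤ t, X i = p i} := by
  rw [W.quenchedLaw_path η p h0 t]
  exact CanonicallyOrderedAdd.prod_pos.2 fun i _ => hp i _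

end Jumps

section EnvKernel

variable {d : ℕ} {E : Type*} [Finite E] [MeasurableSpace E] [DiscreteMeasurableSpace E]
  (W : Walk d E)

/-- The transition kernel of the environment process: from `η`, move to `θ_{z,1} η` with
probability `α(η, z)`. -/
noncomputable def envKernel : Kernel (Env d E) (Env d E) where
  toFun η := (W.α η).toMeasure.map fun z => shift z 1 η
  measurable' := by
    refine Measure.measurable_of_measurable_coe _ fun B hB => ?_
    have hone : Measurable (B.indicator (1 : Env d E → ℝ≥0∞)) := measurable_one.indicator hB
    simp only [← lintegral_indicator_one hB, W.lintegral_map_shift_α _ hone]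
    exact Finset.measurable_sum _ fun z _ =>
      (W.measurable_α z).mul (hone.comp (measurable_shift z 1))

instance : IsMarkovKernel W.envKernel :=
  ⟨fun _ => Measure.isProbabilityMeasure_map (measurable_of_countable _).aemeasurable⟩

theorem lintegral_envKernel (η : Env d E) {f : Env d E → ℝ≥0∞} (hf : Measurable f) :
    ∫⁻ ζ, f ζ ∂W.envKernel η = ∑ z ∈ W.jumps, W.α η z * f (shift z 1 η) :=
  W.lintegral_map_shift_α η hf

theorem isFeller_envKernel [TopologicalSpace E] [DiscreteTopology E] : IsFeller W.envKernel := by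
  intro f
  have hf : Measurable fun ζ => (f ζ : ℝ≥0∞) := by fun_prop
  simp only [W.lintegral_envKernel _ hf]
  refine continuous_finsetSum _ fun z _ => continuous_iff_continuousAt.2 fun η => ?_
  have hfz : Continuous fun ζ => (f (shift z 1 ζ) : ℝ≥0∞) :=
    ENNReal.continuous_coe.comp (f.continuous.comp (continuous_shift z 1))
  exact ENNReal.Tendsto.mul (W.continuous_α z).continuousAt (Or.inr ENNReal.coe_ne_top)
    hfz.continuousAt (Or.inr (PMF.apply_ne_top _ z))

theorem step_frestrictLe_preimage_shift (η : Env d E) (t : ℕ) (X : ℕ → Fin d → ℤ)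
    {B : Set (Env d E)} (hB : MeasurableSet B) :
    W.step η t (Preorder.frestrictLe t X) {x | shift x ((t + 1 : ℕ) : ℤ) η ∈ B} =
      W.envKernel (shift (X t) t η) B := by
  have hshift : ∀ z, shift (X t + z) ((t + 1 : ℕ) : ℤ) η = shift z 1 (shift (X t) t η) :=
    fun z => by rw [shift_shift, add_comm z, add_comm (1 : ℤ), Nat.cast_succ]
  change ((W.α (shift (X t) t η)).map fun z => X t + z).toMeasure _ =
    (W.α (shift (X t) t η)).toMeasure.map (fun z => shift z 1 (shift (X t) t η)) B
  rw [← PMF.toMeasure_map _ _ (measurable_of_countable _),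
    Measure.map_apply (measurable_of_countable _) (Set.to_countable _).measurableSet,
    Measure.map_apply (measurable_of_countable _) hB]
  congr 1
  ext z
  simp only [Set.mem_preimage, Set.mem_ofPred_eq, hshift]

theorem quenchedLaw_succ_mem (η : Env d E) (t : ℕ) {B : Set (Env d E)} (hB : MeasurableSet B) :
    W.quenchedLaw η {X | shift (X (t + 1)) ((t + 1 : ℕ) : ℤ) η ∈ B} =
      ∫⁻ X, W.envKernel (shift (X t) t η) B ∂W.quenchedLaw η := by
  have hS : MeasurableSet {x : Fin d → ℤ | shift x ((t + 1 : ℕ) : ℤ) η ∈ B} :=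
    (Set.to_countable _).measurableSet
  have hpair : Measurable fun X : ℕ → Fin d → ℤ =>
      (Preorder.frestrictLe (π := fun _ => Fin d → ℤ) t X, X (t + 1)) :=
    (Preorder.measurable_frestrictLe t).prodMk (measurable_pi_apply _)
  have hpre : {X : ℕ → Fin d → ℤ | shift (X (t + 1)) ((t + 1 : ℕ) : ℤ) η ∈ B} =
      (fun X => (Preorder.frestrictLe (π := fun _ => Fin d → ℤ) t X, X (t + 1))) ⁻¹'
        (Set.univ ×ˢ {x | shift x ((t + 1 : ℕ) : ℤ) η ∈ B}) := by
    ext X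
    simp only [Set.univ_prod, Set.mem_preimage, Set.mem_ofPred_eq]
  rw [hpre, ← Measure.map_apply hpair (MeasurableSet.univ.prod hS), quenchedLaw,
    ← Kernel.partialTraj_compProd_eq_map_traj (Nat.zero_le t),
    Measure.compProd_apply_prod MeasurableSet.univ hS, Measure.restrict_univ,
    ← Kernel.traj_map_frestrictLe_apply,
    lintegral_map (Kernel.measurable_coe _ hS) (Preorder.measurable_frestrictLe t)]
  exact lintegral_congr fun X => W.step_frestrictLe_preimage_shift η t X hB

variable (Q : Measure (Env d E))

theorem envLaw_zero [SFinite Q] : W.envLaw Q 0 = Q := by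
  have hfst : envProcess 0 =ᵐ[W.jointLaw Q] Prod.fst := by
    have h0 : ∀ᵐ ω ∂W.jointLaw Q, ω.2 0 = 0 :=
      Measure.ae_compProd_of_ae_ae
        (measurableSet_eq_fun ((measurable_pi_apply 0).comp measurable_snd) measurable_const)
        (.of_forall W.ae_quenchedLaw_zero)
    filter_upwards [h0] with ω hω
    rw [envProcess, hω, Nat.cast_zero, shift_zero]
  rw [envLaw, Measure.map_congr hfst]
  exact Measure.fst_compProd Q W.quenched

theorem envLaw_succ [SFinite Q] (t : ℕ) : W.envLaw Q (t + 1) = W.envKernel ∘ₘ W.envLaw Q t := by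
  ext B hB
  have hK : Measurable fun η => W.envKernel η B := W.envKernel.measurable_coe hB
  rw [Measure.bind_apply hB W.envKernel.aemeasurable, envLaw, envLaw,
    Measure.map_apply (measurable_envProcess _) hB, lintegral_map hK (measurable_envProcess t),
    jointLaw, Measure.compProd_apply (measurable_envProcess _ hB),
    Measure.lintegral_compProd (f := fun ω => W.envKernel (envProcess t ω) B)
      (hK.comp (measurable_envProcess t))]
  exact lintegral_congr fun η => W.quenchedLaw_succ_mem η t hB

variable {Q}

theorem isInvariant_of_envKernel_invariant [SFinite Q] (hQ : W.envKernel.Invariant Q) :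
    W.IsInvariant Q := by
  intro t
  induction t with
  | zero => exact W.envLaw_zero Q
  | succ t ih => rw [envLaw_succ, ih, hQ.def]

theorem envLaw_le_measure_iUnion_shift [SFinite Q] (t : ℕ) {B : Set (Env d E)}
    (hB : MeasurableSet B) : W.envLaw Q t B ≤ Q (⋃ x : Fin d → ℤ, shift x t ⁻¹' B) := by
  have hU : MeasurableSet (⋃ x : Fin d → ℤ, shift (E := E) x t ⁻¹' B) :=
    .iUnion fun x => measurable_shift x t hB
  calc W.envLaw Q t B = W.jointLaw Q (envProcess t ⁻¹' B) :=
        Measure.map_apply (measurable_envProcess t) hB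
    _ ≤ W.jointLaw Q (Prod.fst ⁻¹' ⋃ x : Fin d → ℤ, shift x t ⁻¹' B) :=
        measure_mono fun ω hω => Set.mem_iUnion.2 ⟨ω.2 t, hω⟩
    _ = (W.jointLaw Q).fst (⋃ x : Fin d → ℤ, shift x t ⁻¹' B) := (Measure.fst_apply hU).symm
    _ = Q (⋃ x : Fin d → ℤ, shift x t ⁻¹' B) := by rw [jointLaw, Measure.fst_compProd]

theorem measure_shift_preimage_eq_zero_of_envLaw [SFinite Q] {p : ℕ → Fin d → ℤ} (h0 : p 0 = 0)
    (hp : ∀ i η, 0 < W.α η (p (i + 1) - p i)) {t : ℕ} {B : Set (Env d E)} (hB : MeasurableSet B)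
    (h : W.envLaw Q t B = 0) : Q (shift (p t) t ⁻¹' B) = 0 := by
  rw [envLaw, Measure.map_apply (measurable_envProcess t) hB] at h
  have hjoint : ∀ᵐ ω ∂Q ⊗ₘ W.quenched, envProcess t ω ∉ B := measure_eq_zero_iff_ae_notMem.1 h
  have hnot : ∀ᵐ η ∂Q, ∀ᵐ X ∂W.quenched η, envProcess t (η, X) ∉ B :=
    Measure.ae_ae_of_ae_compProd hjoint
  refine measure_eq_zero_iff_ae_notMem.2 (hnot.mono fun η hη hmem => ?_)
  refine (W.quenchedLaw_path_pos h0 hp η t).ne' (measure_eq_zero_iff_ae_notMem.2 ?_)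
  filter_upwards [hη] with X hXB hX
  simp only [envProcess, hX t le_rfl] at hXB
  exact hXB hmem

end EnvKernel

end Walk

section Observations

variable {d : ℕ} {E : Type*}

/-- The event that the environments seen along the path `γ` at the times `-k, …, -1` show the
patterns `τ`: the event of `𝓐_{-∞}` given by `k` and `γ` when `γ` is a backward path of the walk,
up to its having positive probability. -/
def pathEvent (R k : ℕ) (γ : ℤ → Fin d → ℤ) (τ : ℤ → Box d R → E) : Set (Env d E) :=
  {η | ∀ i : ℤ, -k ≤ i → i ≤ -1 → pattern R (shift (γ i) i η) = τ i}

/-- The path `γ`, prolonged by the jump `z` and translated in space-time so as to end again at the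
origin. -/
def prolongPath (γ : ℤ → Fin d → ℤ) (z : Fin d → ℤ) (i : ℤ) : Fin d → ℤ :=
  if i = 0 then 0 else γ (i + 1) - z

/-- The record `τ` of the patterns seen along a path, prolonged by the pattern `τ₀` seen at its end
and translated in time along with the path. -/
def prolongRecord {R : ℕ} (τ : ℤ → Box d R → E) (τ₀ : Box d R → E) (i : ℤ) : Box d R → E :=
  if i = -1 then τ₀ else τ (i + 1)

theorem pathEvent_zero (R : ℕ) (γ : ℤ → Fin d → ℤ) (τ : ℤ → Box d R → E) :
    pathEvent R 0 γ τ = Set.univ :=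
  Set.eq_univ_of_forall fun _ _ h h' => absurd (h.trans h') (by norm_num)

theorem measurableSet_pathEvent [Finite E] [MeasurableSpace E] [DiscreteMeasurableSpace E]
    (R k : ℕ) (γ : ℤ → Fin d → ℤ) (τ : ℤ → Box d R → E) : MeasurableSet (pathEvent R k γ τ) := by
  simp only [pathEvent, Set.ofPred_forall]
  exact .iInter fun i => .iInter fun _ => .iInter fun _ =>
    ((measurable_pattern R).comp (Walk.measurable_shift (γ i) i)) (measurableSet_singleton (τ i))

theorem shift_prolongPath {i : ℤ} (hi : i ≠ 0) (γ : ℤ → Fin d → ℤ) (z : Fin d → ℤ) (η : Env d E) :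
    shift (prolongPath γ z i) i η = shift (γ (i + 1)) (i + 1) (shift (-z) (-1) η) := by
  rw [shift_shift, prolongPath, if_neg hi, sub_eq_add_neg, add_neg_cancel_right]

theorem shift_preimage_pathEvent_inter_pattern (R k : ℕ) {γ : ℤ → Fin d → ℤ} (hγ : γ 0 = 0)
    (τ : ℤ → Box d R → E) (τ₀ : Box d R → E) (z : Fin d → ℤ) :
    shift (-z) (-1) ⁻¹' (pathEvent R k γ τ ∩ pattern R ⁻¹' {τ₀}) =
      pathEvent R (k + 1) (prolongPath γ z) (prolongRecord τ τ₀) := by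
  have hlast : ∀ η : Env d E, shift (prolongPath γ z (-1)) (-1) η = shift (-z) (-1) η := fun η => by
    rw [shift_prolongPath (by norm_num), neg_add_cancel, hγ, shift_zero]
  ext η
  constructor
  · rintro ⟨hpath, hend⟩ i hi hi'
    by_cases h : i = -1
    · rw [h, hlast, prolongRecord, if_pos rfl]
      exact hend
    · rw [shift_prolongPath (by omega), prolongRecord, if_neg h]
      exact hpath (i + 1) (by push_cast at hi; omega) (by omega)
  · refine fun h => ⟨fun i hi hi' => ?_, ?_⟩
    · have hstep := h (i - 1) (by push_cast; omega) (by omega)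
      rwa [shift_prolongPath (by omega), prolongRecord, if_neg (by omega), sub_add_cancel] at hstep
    · have hend := h (-1) (by push_cast; omega) le_rfl
      rwa [hlast, prolongRecord, if_pos rfl] at hend

namespace Walk

variable (W : Walk d E)

/-- `γ_{-k}, …, γ_0` is a backward path of the walk ending at the origin. -/
structure IsBackwardPath (k : ℕ) (γ : ℤ → Fin d → ℤ) : Prop where
  apply_zero : γ 0 = 0
  sub_mem_jumpRange : ∀ i : ℤ, -k < i → i ≤ 0 → γ i - γ (i - 1) ∈ W.jumpRange

theorem isBackwardPath_zero : W.IsBackwardPath 0 0 :=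
  ⟨rfl, fun _ h h' => absurd (h.trans_le h') (by norm_num)⟩

variable {W}

theorem IsBackwardPath.prolong {k : ℕ} {γ : ℤ → Fin d → ℤ} (hγ : W.IsBackwardPath k γ)
    {z : Fin d → ℤ} (hz : z ∈ W.jumpRange) : W.IsBackwardPath (k + 1) (prolongPath γ z) := by
  refine ⟨if_pos rfl, fun i hi hi' => ?_⟩
  rcases hi'.eq_or_lt with rfl | hi0
  · simpa [prolongPath, hγ.apply_zero] using hz
  · have hstep := hγ.sub_mem_jumpRange (i + 1) (by push_cast at hi; omega) (by omega)
    rw [add_sub_cancel_right] at hstep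
    simpa only [prolongPath, hi0.ne, if_false, if_neg (show i - 1 ≠ 0 by omega), sub_add_cancel,
      sub_sub_sub_cancel_right] using hstep

theorem IsBackwardPath.pathEvent_mem_observations [MeasurableSpace E] {k : ℕ} (hk : 1 ≤ k)
    {γ : ℤ → Fin d → ℤ} (hγ : W.IsBackwardPath k γ) (τ : ℤ → Box d W.R → E)
    {P : Measure (Env d E)} (hP : 0 < P (pathEvent W.R k γ τ)) :
    pathEvent W.R k γ τ ∈ W.observations P := by
  obtain ⟨η₀, hη₀⟩ := nonempty_of_measure_ne_zero hP.ne'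
  refine ⟨k, γ, fun p => shift (γ p.2) p.2 η₀ (p.1, 0), hk, hγ.apply_zero, hγ.sub_mem_jumpRange,
    ?_, hP⟩
  ext η
  refine forall₃_congr fun i hi hi' => ?_
  rw [← hη₀ i hi hi', funext_iff, Subtype.forall]
  rfl

end Walk

end Observations

section Stationary

variable {d : ℕ} {E : Type*} [MeasurableSpace E]

/-- Invariance of a measure on environments under all space-time shifts. -/
def IsStationary (P : Measure (Env d E)) : Prop :=
  ∀ (x : Fin d → ℤ) (t : ℤ), P.map (shift x t) = P

variable {P : Measure (Env d E)}

theorem IsStationary.measure_preimage (hP : IsStationary P) (x : Fin d → ℤ) (t : ℤ)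
    {B : Set (Env d E)} (hB : MeasurableSet B) : P (shift x t ⁻¹' B) = P B := by
  rw [← Measure.map_apply (Walk.measurable_shift x t) hB, hP]

theorem IsStationary.map_restrict (hP : IsStationary P) (x : Fin d → ℤ) (t : ℤ)
    {A : Set (Env d E)} (hA : MeasurableSet A) :
    (P.restrict A).map (shift x t) = P.restrict (shift (-x) (-t) ⁻¹' A) := by
  have hcancel : shift x t ⁻¹' (shift (-x) (-t) ⁻¹' A) = A := by
    ext η
    simp only [Set.mem_preimage, shift_shift, neg_add_cancel, shift_zero]
  conv_rhs => rw [← hP x t]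
  rw [Measure.restrict_map (Walk.measurable_shift x t) (Walk.measurable_shift _ _ hA), hcancel]

end Stationary

namespace Walk

section ObservationSpan

variable {d : ℕ} {E : Type*} [MeasurableSpace E] (W : Walk d E) (P : Measure (Env d E))

/-- The convex cone generated by the restrictions of `P` to the events recording the environment
along backward paths. For stationary `P` it contains the laws of the environment process. -/
noncomputable def observationSpan : Submodule ℝ≥0∞ (Measure (Env d E)) :=
  Submodule.span ℝ≥0∞
    {ν | ∃ k γ τ, W.IsBackwardPath k γ ∧ ν = P.restrict (pathEvent W.R k γ τ)}

theorem self_mem_observationSpan [IsProbabilityMeasure P] : P ∈ W.observationSpan P := by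
  obtain ⟨η⟩ : Nonempty (Env d E) := nonempty_of_isProbabilityMeasure P
  refine Submodule.subset_span ⟨0, 0, fun _ => pattern W.R η, W.isBackwardPath_zero, ?_⟩
  rw [pathEvent_zero, Measure.restrict_univ]

variable [Finite E] [DiscreteMeasurableSpace E]

theorem observationSpan_le_fractionLE [IsProbabilityMeasure P] {B : Set (Env d E)}
    (hB : MeasurableSet B) {q : ℝ≥0∞} (hPB : P B ≤ q) (hq : ∀ A ∈ W.observations P, P[|A] B ≤ q) :
    W.observationSpan P ≤ fractionLE B q := by
  refine Submodule.span_le.2 ?_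
  rintro _ ⟨k, γ, τ, hγ, rfl⟩
  rcases Nat.eq_zero_or_pos k with rfl | hk
  · rw [pathEvent_zero, Measure.restrict_univ, SetLike.mem_coe, mem_fractionLE, measure_univ,
      mul_one]
    exact hPB
  rcases eq_or_ne (P (pathEvent W.R k γ τ)) 0 with hnull | hpos
  · rw [Measure.restrict_eq_zero.2 hnull]
    exact Submodule.zero_mem _
  · exact restrict_mem_fractionLE (measurableSet_pathEvent _ _ _ _) hB
      (hq _ (hγ.pathEvent_mem_observations hk τ (pos_iff_ne_zero.2 hpos)))

theorem envKernel_comp_restrict_pattern (ν : Measure (Env d E)) (η : Env d E) :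
    W.envKernel ∘ₘ ν.restrict (pattern W.R ⁻¹' {pattern W.R η}) =
      ∑ z ∈ W.jumps, W.α η z • (ν.restrict (pattern W.R ⁻¹' {pattern W.R η})).map (shift z 1) := by
  have hfiber : MeasurableSet (pattern W.R ⁻¹' {pattern W.R η}) :=
    measurable_pattern W.R (measurableSet_singleton _)
  ext B hB
  have hone : Measurable (B.indicator (1 : Env d E → ℝ≥0∞)) := measurable_one.indicator hB
  have hshift : ∀ z, Measurable fun ζ => B.indicator (1 : Env d E → ℝ≥0∞) (shift z 1 ζ) :=
    fun z => hone.comp (measurable_shift z 1)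
  have hK : ∀ ζ ∈ pattern W.R ⁻¹' {pattern W.R η},
      W.envKernel ζ B = ∑ z ∈ W.jumps, W.α η z * B.indicator 1 (shift z 1 ζ) := fun ζ hζ => by
    rw [← lintegral_indicator_one hB, W.lintegral_envKernel ζ hone, W.α_eq_of_pattern_eq hζ]
  rw [Measure.bind_apply hB W.envKernel.aemeasurable, setLIntegral_congr_fun hfiber hK,
    lintegral_finsetSum _ fun z _ => (hshift z).const_mul _,
    Measure.finsetSum_apply]
  refine Finset.sum_congr rfl fun z _ => ?_
  rw [lintegral_const_mul _ (hshift z), Measure.smul_apply, smul_eq_mul,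
    ← lintegral_map hone (measurable_shift z 1), lintegral_indicator_one hB]

variable {P}

theorem envKernel_comp_restrict_pathEvent_mem (hP : IsStationary P) {k : ℕ}
    {γ : ℤ → Fin d → ℤ} (hγ : W.IsBackwardPath k γ) (τ : ℤ → Box d W.R → E) :
    W.envKernel ∘ₘ P.restrict (pathEvent W.R k γ τ) ∈ W.observationSpan P := by
  have : Fintype (Box d W.R → E) := Fintype.ofFinite _
  rw [← sum_restrict_preimage_singleton (measurable_pattern W.R) (P.restrict _), comp_finsetSum]
  refine Submodule.sum_mem _ fun τ₀ _ => ?_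
  rcases (pattern W.R ⁻¹' {τ₀} : Set (Env d E)).eq_empty_or_nonempty with hempty | ⟨η, rfl⟩
  · rw [hempty, Measure.restrict_empty, Measure.bind_zero_left]
    exact Submodule.zero_mem _
  rw [envKernel_comp_restrict_pattern]
  refine Submodule.sum_mem _ fun z hz => Submodule.smul_mem _ _ (Submodule.subset_span ?_)
  refine ⟨k + 1, prolongPath γ z, prolongRecord τ (pattern W.R η),
    hγ.prolong (W.finite_jumpRange.mem_toFinset.1 hz), ?_⟩
  have hfiber : MeasurableSet (pattern W.R ⁻¹' {pattern W.R η}) :=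
    measurable_pattern W.R (measurableSet_singleton _)
  rw [Measure.restrict_restrict hfiber, Set.inter_comm,
    hP.map_restrict z 1 ((measurableSet_pathEvent _ _ _ _).inter hfiber),
    shift_preimage_pathEvent_inter_pattern _ _ hγ.apply_zero]

theorem envKernel_comp_mem_observationSpan (hP : IsStationary P) {ν : Measure (Env d E)}
    (hν : ν ∈ W.observationSpan P) : W.envKernel ∘ₘ ν ∈ W.observationSpan P := by
  induction hν using Submodule.span_induction with
  | mem ν hν =>
    obtain ⟨k, γ, τ, hγ, rfl⟩ := hν
    exact W.envKernel_comp_restrict_pathEvent_mem hP hγ τ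
  | zero =>
    rw [Measure.bind_zero_left]
    exact Submodule.zero_mem _
  | add μ ν _ _ hμ hν =>
    rw [Measure.comp_add]
    exact Submodule.add_mem _ hμ hν
  | smul c ν _ hν =>
    rw [Measure.comp_smul]
    exact Submodule.smul_mem _ c hν

theorem envLaw_mem_observationSpan [IsProbabilityMeasure P] (hP : IsStationary P) (t : ℕ) :
    W.envLaw P t ∈ W.observationSpan P := by
  induction t with
  | zero =>
    rw [envLaw_zero]
    exact W.self_mem_observationSpan P
  | succ t ih =>
    rw [envLaw_succ]
    exact W.envKernel_comp_mem_observationSpan hP ih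

theorem cesaro_mem_observationSpan {P : ProbabilityMeasure (Env d E)}
    (hP : IsStationary (P : Measure (Env d E))) (n : ℕ) :
    (W.cesaro P n : Measure (Env d E)) ∈ W.observationSpan (P : Measure (Env d E)) := by
  change ((n : ℝ≥0∞) + 1)⁻¹ • ∑ t ∈ Finset.range (n + 1), W.envLaw (P : Measure (Env d E)) t ∈ _
  exact Submodule.smul_mem _ _ (Submodule.sum_mem _ fun t _ => W.envLaw_mem_observationSpan hP t)

theorem cesaro_le_add {P : ProbabilityMeasure (Env d E)}
    (hP : IsStationary (P : Measure (Env d E))) {B : Set (Env d E)} (hB : MeasurableSet B)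
    {c : ℝ≥0∞} (hc : ∀ A ∈ W.observations (P : Measure (Env d E)),
      (P : Measure (Env d E))[|A] B ≤ (P : Measure (Env d E)) B + c) (n : ℕ) :
    (W.cesaro P n : Measure (Env d E)) B ≤ (P : Measure (Env d E)) B + c := by
  have hle := mem_fractionLE.1 <| W.observationSpan_le_fractionLE (P : Measure (Env d E)) hB
    le_self_add hc (W.cesaro_mem_observationSpan hP n)
  rwa [measure_univ, mul_one] at hle

end ObservationSpan

end Walk

section CylinderEvents

variable {d : ℕ} {E : Type*} [MeasurableSpace E]

/-- The clopen events that depend on the coordinates in `Δ` only. They generate `𝓕_Δ`, and weak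
convergence of measures is convergence on each of them. -/
def clopenEvents [TopologicalSpace E] (Δ : Set (Site d)) : Set (Set (Env d E)) :=
  {B | IsClopen B ∧ MeasurableSet[cylinderEvents Δ] B}

theorem isSetAlgebra_clopenEvents [TopologicalSpace E] (Δ : Set (Site d)) :
    IsSetAlgebra (clopenEvents (E := E) Δ) where
  empty_mem := ⟨isClopen_empty, @MeasurableSet.empty _ (cylinderEvents Δ)⟩
  compl_mem _ h := ⟨h.1.compl, h.2.compl⟩
  union_mem _ _ h h' := ⟨h.1.union h'.1, h.2.union h'.2⟩

theorem generateFrom_clopenEvents [TopologicalSpace E] [DiscreteTopology E] (Δ : Set (Site d)) :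
    MeasurableSpace.generateFrom (clopenEvents (E := E) Δ) = cylinderEvents Δ := by
  refine le_antisymm (MeasurableSpace.generateFrom_le fun B hB => hB.2) (iSup₂_le fun p hp => ?_)
  rintro _ ⟨S, hS, rfl⟩
  exact MeasurableSpace.measurableSet_generateFrom
    ⟨(isClopen_discrete S).preimage (continuous_apply p), measurable_cylinderEvent_apply hp hS⟩

theorem measurable_shift_cylinderEvents {Δ Δ' : Set (Site d)} (x : Fin d → ℤ) (t : ℤ)
    (h : ∀ p ∈ Δ, (p.1 + x, p.2 + t) ∈ Δ') :
    Measurable[cylinderEvents Δ', cylinderEvents Δ] (shift (E := E) x t) := by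
  let : MeasurableSpace (Env d E) := cylinderEvents Δ'
  exact measurable_cylinderEvents_iff.2 fun p hp => measurable_cylinderEvent_apply (h p hp)

theorem measurable_shift_farHalfSpace (x : Fin d → ℤ) (t : ℕ) :
    Measurable[cylinderEvents (farHalfSpace d t), cylinderEvents (halfSpace d)]
      (shift (E := E) x t) := by
  refine measurable_shift_cylinderEvents x t fun p (hp : 0 ≤ p.2) => ?_
  exact ⟨by dsimp only; omega, by dsimp only; omega⟩

theorem forwardCone_subset_farHalfSpace (d R j : ℕ) : forwardCone d R j ⊆ farHalfSpace d j :=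
  fun p hp => ⟨hp.1, by have := hp.2.2; omega⟩

theorem coneTail_le_halfSpaceTail (d : ℕ) (E : Type*) [MeasurableSpace E] (R : ℕ) :
    coneTail d E R ≤ halfSpaceTail d E :=
  iInf_mono fun j => cylinderEvents_mono (forwardCone_subset_farHalfSpace d R j)

end CylinderEvents

namespace Walk

section EnvLimit

variable {d : ℕ} {E : Type*} [Finite E] [MeasurableSpace E] [DiscreteMeasurableSpace E]
  (W : Walk d E)

theorem envKernel_comp_cesaro_add (P : ProbabilityMeasure (Env d E)) (n : ℕ) :
    W.envKernel ∘ₘ (W.cesaro P n : Measure (Env d E)) +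
        ((n : ℝ≥0∞) + 1)⁻¹ • (P : Measure (Env d E)) =
      W.cesaro P n + ((n : ℝ≥0∞) + 1)⁻¹ • W.envLaw (P : Measure (Env d E)) (n + 1) := by
  change W.envKernel ∘ₘ (((n : ℝ≥0∞) + 1)⁻¹ • ∑ t ∈ Finset.range (n + 1), W.envLaw P t) + _ =
    ((n : ℝ≥0∞) + 1)⁻¹ • ∑ t ∈ Finset.range (n + 1), W.envLaw P t + _
  rw [Measure.comp_smul, comp_finsetSum, ← smul_add, ← smul_add, ← Finset.sum_range_succ,
    Finset.sum_range_succ' _ (n + 1), envLaw_zero]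
  simp only [envLaw_succ]

variable [TopologicalSpace E] [DiscreteTopology E]

theorem exists_isEnvLimit (P : ProbabilityMeasure (Env d E)) : ∃ Q, W.IsEnvLimit P Q := by
  obtain ⟨Q, n, hn, hQ⟩ := CompactSpace.tendsto_subseq (W.cesaro P)
  exact ⟨Q, n, hn, hQ⟩

variable {W} {P Q : ProbabilityMeasure (Env d E)}

theorem IsEnvLimit.isInvariant (h : W.IsEnvLimit P Q) :
    W.IsInvariant (Q : Measure (Env d E)) := by
  obtain ⟨n, hn, hQ⟩ := h
  have hinv : Tendsto (fun k => ((n k : ℝ≥0∞) + 1)⁻¹) atTop (𝓝 0) := by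
    have := (tendsto_add_atTop_iff_nat 1).2 ENNReal.tendsto_inv_nat_nhds_zero
    simpa only [Nat.cast_add, Nat.cast_one, Function.comp_def] using this.comp hn.tendsto_atTop
  exact W.isInvariant_of_envKernel_invariant <| W.isFeller_envKernel.invariant_of_tendsto hQ hinv
    fun k => W.envKernel_comp_cesaro_add P (n k)

theorem IsEnvLimit.measure_le_add_of_isClopen (h : W.IsEnvLimit P Q)
    (hP : IsStationary (P : Measure (Env d E))) {B : Set (Env d E)} (hB : IsClopen B) {c : ℝ≥0∞}
    (hc : ∀ A ∈ W.observations (P : Measure (Env d E)),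
      (P : Measure (Env d E))[|A] B ≤ (P : Measure (Env d E)) B + c) :
    (Q : Measure (Env d E)) B ≤ (P : Measure (Env d E)) B + c := by
  obtain ⟨n, -, hQ⟩ := h
  have hlim : Tendsto (fun k => (W.cesaro P (n k) : Measure (Env d E)) B) atTop
      (𝓝 ((Q : Measure (Env d E)) B)) :=
    ProbabilityMeasure.tendsto_measure_of_null_frontier_of_tendsto' hQ (by simp [hB.frontier_eq])
  exact le_of_tendsto' hlim fun k => W.cesaro_le_add hP hB.isOpen.measurableSet hc (n k)

theorem IsEnvLimit.closeOn (h : W.IsEnvLimit P Q) (hP : IsStationary (P : Measure (Env d E)))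
    {Δ : Set (Site d)} {ε : ℝ} (hε : 0 ≤ ε)
    (hmix : ∀ A ∈ W.observations (P : Measure (Env d E)),
      CloseOn (cylinderEvents Δ) ε (P : Measure (Env d E))[|A] P) :
    CloseOn (cylinderEvents Δ) ε (Q : Measure (Env d E)) P := by
  have hclopen : ∀ B ∈ clopenEvents Δ,
      (Q : Measure (Env d E)) B ≤ (P : Measure (Env d E)) B + ENNReal.ofReal ε := fun B hB =>
    h.measure_le_add_of_isClopen hP hB.1 fun A hA => (hmix A hA).measure_le_add hB.2
  have hgen := generateFrom_clopenEvents (E := E) Δ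
  have hle := hgen.le.trans cylinderEvents_le_pi
  exact .of_forall_le_add cylinderEvents_le_pi hε fun B hB =>
    measure_le_add_of_isSetAlgebra (isSetAlgebra_clopenEvents Δ) hle hclopen (hgen.symm ▸ hB)

end EnvLimit

section AbsoluteContinuity

variable {d : ℕ} {E : Type*} [Finite E] [MeasurableSpace E] [DiscreteMeasurableSpace E]
  {W : Walk d E} {P Q : Measure (Env d E)} [IsFiniteMeasure P] [IsFiniteMeasure Q] {φ : ℕ → ℝ}
  {B : Set (Env d E)}

theorem IsInvariant.measure_eq_zero (hQ : W.IsInvariant Q) (hP : IsStationary P)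
    (hQP : ∀ l, CloseOn (cylinderEvents (farHalfSpace d l)) (φ l) Q P)
    (hφ : Tendsto φ atTop (𝓝 0)) (hB : MeasurableSet[cylinderEvents (halfSpace d)] B)
    (hnull : P B = 0) : Q B = 0 := by
  have hBm : MeasurableSet B := cylinderEvents_le_pi B hB
  have hU : ∀ l : ℕ, MeasurableSet[cylinderEvents (farHalfSpace d l)]
      (⋃ x : Fin d → ℤ, shift x l ⁻¹' B) := fun l =>
    .iUnion fun x => measurable_shift_farHalfSpace x l hB
  have hPU : ∀ l : ℕ, P (⋃ x : Fin d → ℤ, shift x l ⁻¹' B) = 0 := fun l =>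
    measure_iUnion_null fun x => (hP.measure_preimage x l hBm).trans hnull
  refine CloseOn.measure_eq_zero hQP hφ hU hPU fun l => ?_
  simpa only [hQ l] using W.envLaw_le_measure_iUnion_shift (Q := Q) l hBm

theorem IsInvariant.measure_eq_zero_of_isStationary (hQ : W.IsInvariant Q) (hP : IsStationary P)
    (hPQ : ∀ l, CloseOn (cylinderEvents (farHalfSpace d l)) (φ l) P Q)
    (hφ : Tendsto φ atTop (𝓝 0)) {z : Fin d → ℤ} (hz : ∀ η, 0 < W.α η z)
    (hB : MeasurableSet[cylinderEvents (halfSpace d)] B) (hnull : Q B = 0) : P B = 0 := by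
  have hBm : MeasurableSet B := cylinderEvents_le_pi B hB
  have hpath : ∀ (i : ℕ) (η : Env d E), 0 < W.α η ((i + 1) • z - i • z) := fun i η => by
    rw [succ_nsmul, add_sub_cancel_left]
    exact hz η
  refine CloseOn.measure_eq_zero hPQ hφ (fun l => measurable_shift_farHalfSpace (l • z) l hB)
    (fun l => ?_) fun l => (hP.measure_preimage (l • z) l hBm).ge
  exact W.measure_shift_preimage_eq_zero_of_envLaw (p := fun i => i • z) (zero_nsmul z) hpath hBm
    (by rw [hQ l, hnull])

end AbsoluteContinuity

end Walk

end RWDRE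

open RWDRE in
theorem theorem1p4_general {d : ℕ} {E : Type*} [Finite E] [TopologicalSpace E]
    [DiscreteTopology E] [MeasurableSpace E] [DiscreteMeasurableSpace E] (W : Walk d E)
    (P : ProbabilityMeasure (Env d E)) (hP : IsStationary (P : Measure (Env d E))) (φ : ℕ → ℝ)
    (hφ : ∀ l, 0 ≤ φ l) (hφ0 : Tendsto φ atTop (𝓝 0))
    (hmix : ∀ l, ∀ A ∈ W.observations (P : Measure (Env d E)),
      CloseOn (cylinderEvents (farHalfSpace d l)) (φ l) (P : Measure (Env d E))[|A] P) :
    (∃ Q : ProbabilityMeasure (Env d E), W.IsEnvLimit P Q) ∧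
    ∀ Q : ProbabilityMeasure (Env d E), W.IsEnvLimit P Q →
      W.IsInvariant (Q : Measure (Env d E)) ∧
      (∀ B, MeasurableSet[halfSpaceTail d E] B →
        (Q : Measure (Env d E)) B = (P : Measure (Env d E)) B) ∧
      (∀ l, CloseOn (cylinderEvents (farHalfSpace d l)) (φ l) P (Q : Measure (Env d E))) ∧
      (∀ B, MeasurableSet[cylinderEvents (halfSpace d)] B →
        (P : Measure (Env d E)) B = 0 → (Q : Measure (Env d E)) B = 0) ∧
      ((∃ z, ∀ η, 0 < W.α η z) → ∀ B, MeasurableSet[cylinderEvents (halfSpace d)] B →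
        (Q : Measure (Env d E)) B = 0 → (P : Measure (Env d E)) B = 0) := by
  refine ⟨W.exists_isEnvLimit P, fun Q hQ => ?_⟩
  have hinv := hQ.isInvariant
  have hQP : ∀ l, CloseOn (cylinderEvents (farHalfSpace d l)) (φ l) (Q : Measure (Env d E)) P :=
    fun l => hQ.closeOn hP (hφ l) (hmix l)
  have hPQ := fun l => (hQP l).symm
  refine ⟨hinv, fun B hB => CloseOn.measure_eq_of_iInf hQP hφ0 hB, hPQ,
    fun B hB => hinv.measure_eq_zero hP hQP hφ0 hB, ?_⟩
  rintro ⟨z, hz⟩ B hB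
  exact hinv.measure_eq_zero_of_isStationary hP hPQ hφ0 hz hB

theorem theorem1p4 {d : ℕ} {E : Type*} [Finite E] [TopologicalSpace E] [DiscreteTopology E]
    [MeasurableSpace E] [DiscreteMeasurableSpace E]
    (W : RWDRE.Walk d E) (P : ProbabilityMeasure (RWDRE.Env d E))
    (hP : ∀ (x : Fin d → ℤ) (t : ℤ),
      Measure.map (RWDRE.shift x t) (P : Measure (RWDRE.Env d E)) = P)
    (φ : ℕ → ℝ) (hφ : ∀ l, φ l ∈ Set.Icc (0 : ℝ) 1) (hφ0 : Tendsto φ atTop (𝓝 0))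
    (hmix : ∀ l : ℕ, ∀ B : Set (RWDRE.Env d E),
      MeasurableSet[cylinderEvents (RWDRE.farHalfSpace d l)] B →
      ∀ A ∈ W.observations (P : Measure (RWDRE.Env d E)),
        |((P : Measure (RWDRE.Env d E))[|A]).real B
          - (P : Measure (RWDRE.Env d E)).real B| ≤ φ l) :
    -- a law `P^{EP}` exists
    (∃ PEP : ProbabilityMeasure (RWDRE.Env d E), W.IsEnvLimit P PEP) ∧
    ∀ PEP : ProbabilityMeasure (RWDRE.Env d E), W.IsEnvLimit P PEP →
      -- it is invariant and equals `P` on the tail of the forward cone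
      W.IsInvariant (PEP : Measure (RWDRE.Env d E)) ∧
      (∀ B, MeasurableSet[RWDRE.coneTail d E W.R] B →
        (PEP : Measure (RWDRE.Env d E)) B = (P : Measure (RWDRE.Env d E)) B) ∧
      -- it equals `P` on the tail of the forward half-space
      (∀ B, MeasurableSet[RWDRE.halfSpaceTail d E] B →
        (PEP : Measure (RWDRE.Env d E)) B = (P : Measure (RWDRE.Env d E)) B) ∧
      -- quantitative bound
      (∀ l : ℕ, ∀ B, MeasurableSet[cylinderEvents (RWDRE.farHalfSpace d l)] B →
        |(P : Measure (RWDRE.Env d E)).real B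
          - (PEP : Measure (RWDRE.Env d E)).real B| ≤ φ l) ∧
      -- mutual absolute continuity on the forward half-space
      (W.IsElliptic →
        ∀ B, MeasurableSet[cylinderEvents (RWDRE.halfSpace d)] B →
          ((P : Measure (RWDRE.Env d E)) B = 0 ↔ (PEP : Measure (RWDRE.Env d E)) B = 0)) := by
  obtain ⟨hexists, hlimit⟩ := theorem1p4_general W P hP φ (fun l => (hφ l).1) hφ0
    fun l A hA B hB => hmix l B hB A hA
  refine ⟨hexists, fun Q hQ => ?_⟩
  obtain ⟨hinv, htail, hclose, hQP, hPQ⟩ := hlimit Q hQ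
  exact ⟨hinv, fun B hB => htail B (RWDRE.coneTail_le_halfSpaceTail d E W.R B hB), htail, hclose,
    fun hW B hB => ⟨hQP B hB, hPQ ⟨0, hW 0 W.zero_mem⟩ B hB⟩⟩
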